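/- A signed index is a finite sequence $(s_1,\dots,s_l)$ in which each $s_j$ is a positive integer that may carry a bar; put $x_j=-1$ if $s_j$ is barred and $x_j=1$ otherwise. Its weight is $s_1+\cdots+s_l$ (bars disregarded). If $s_1$ is not an unbarred $1$, the associated Euler sum is $$\zeta(s_1,\dots,s_l)=\sum_{k_1>\cdots>k_l>0}\ \prod_{j=1}^l\frac{x_j^{k_j}}{k_j^{s_j}},$$ understood as the limit for $N\to\infty$ of the finite sums over $N\ge k_1>\cdots>k_l>0$. Put $A=\zeta(\bar2,1,1)$, $B=\zeta(\bar2,2)$, $C=\zeta(\bar1,2,1)$, $D=\zeta(\bar1,1,2)$ and $E=\zeta(\bar1,1,1,1)$. Then for every signed index of weight $4$ whose first entry is not an unbarred $1$ this limit exists, and the Euler sum is a $\mathbb Z$-linear combination of $A,B,C,D,E$. Explicitly, in length one and two: \begin{align*} \zeta(4)&=64A + 16B\\ \zeta(\bar 4)&=-56A - 14B\\ \zeta(3,1)&=16A + 4B\\ \zeta(3,\bar 1)&=118A + 19B + 14C\\ \zeta(2,2)&=48A + 12B\\ \zeta(\bar 3,1)&=10A + 2B\\ \zeta(\bar 3,\bar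 1)&=-140A - 24B - 14C\\ \zeta(2,\bar 2)&=-24A - 7B\\ \zeta(\bar 2,\bar 2)&=-12A - 3B\\ \zeta(\bar 1,3)&=-38A - 5B - 6C\\ \zeta(\bar 1,\bar 3)&=58A + 8B + 8C \end{align*} in length three: \begin{align*} \zeta(2,1,1)&=64A + 16B\\ \zeta(2,1,\bar 1)&=16A + 2B + 6C + 3D\\ \zeta(2,\bar 1,1)&=22A + 3B + C - 3D\\ \zeta(2,\bar 1,\bar 1)&=100A + 13B + 9C - 6D\\ \zeta(\bar 2,1,\bar 1)&=91A + 14B + 8C - 3D\\ \zeta(\bar 2,\bar 1,1)&=-161A - 26B - 15C + 3D\\ \zeta(\bar 2,\bar 1,\bar 1)&=-101A - 14B - 9C + 6D\\ \zeta(\bar 1,2,\bar 1)&=-102A - 14B - 8C + 6D\\ \zeta(\bar 1,\bar 2,1)&=69A + 11B + 8C\\ \zeta(\bar 1,\bar 2,\bar 1)&=63A + 8B + 3C - 6D\\ \zeta(\bar 1,1,\bar 2)&=21A + 3B + C - 2D\\ \zeta(\bar 1,\bar 1,\bar 2)&=A + 2B + D \end{align*} and in length four: \begin{align*} \zeta(\bar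 1,1,1,\bar 1)&=A + E\\ \zeta(\bar 1,1,\bar 1,1)&=11A + 2B + C + E\\ \zeta(\bar 1,1,\bar 1,\bar 1)&=C + E\\ \zeta(\bar 1,\bar 1,1,1)&=-83A - 16B - 5C + D + E\\ \zeta(\bar 1,\bar 1,1,\bar 1)&=-38A - 5B - 5C + D + E\\ \zeta(\bar 1,\bar 1,\bar 1,1)&=D + E\\ \zeta(\bar 1,\bar 1,\bar 1,\bar 1)&=A + B + D + E \end{align*} -/

import Mathlib

open Filter Topology

noncomputable section

/-- A signed index `(s₁, …, s_l)`, each `s_j` being a positive integer or a barred positive integer,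
is encoded as a list of nonzero integers: the entry `s > 0` stands for the unbarred `s` (with sign
`x_j = 1`), and the entry `-s < 0` for the barred `s` (with sign `x_j = -1`). -/
def IsSignedIndex (k : List ℤ) : Prop :=
  ∀ m ∈ k, m ≠ 0

/-- The weight `s₁ + ⋯ + s_l` of a signed index. -/
def signedWeight (k : List ℤ) : ℕ :=
  (k.map Int.natAbs).sum

/-- The series of a signed index converges exactly when the index does not begin with an
unbarred `1`. -/
def IsConvergentIndex (k : List ℤ) : Prop :=
  IsSignedIndex k ∧ k.head? ≠ some 1

/-- The truncated nested sum
`∑_{N ≥ k₁ > k₂ > ⋯ > k_l > 0} ∏_j x_j ^ k_j / k_j ^ s_j`,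
in which the summation variable `n` stands for `k₁ - 1`, so that the inner sum is over
`n ≥ k₂ > ⋯ > k_l > 0`. -/
def truncatedEulerSum : List ℤ → ℕ → ℝ
  | [], _ => 1
  | m :: k, N => ∑ n ∈ Finset.range N,
      (m.sign : ℝ) ^ (n + 1) / ((n + 1 : ℕ) : ℝ) ^ m.natAbs * truncatedEulerSum k n

/-- The (alternating) Euler sum `ζ(s₁, …, s_l; x₁, …, x_l)`: the limit of the truncated sums
over `k₁ ≤ N` as `N → ∞` (the convergence may be only conditional). -/
def eulerSum (k : List ℤ) : ℝ :=
  limUnder atTop (truncatedEulerSum k)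

end

/-! A product with the one-letter sum of `x = ±1` expands in two ways. As nested sums it gives the
quasi-shuffle, an identity for every truncation. As iterated integrals, modelled by formal power
series, it gives the shuffle, an identity of coefficients. Comparing both gives linear relations
among Euler sums.

For `x = 1` the factor diverges, but the product of partial sums minus the partial sum of the Cauchy
product still tends to 0: one factor has coefficients O(1/n), the other converges at rate 1/√N
(`tendsto_mul_sub_sum_convolution`). The only divergent term, `1 :: k`, occurs on both sides and
cancels.

More relations come from multiplying known relations of lower weight by the convergent `eulerSum
[-1]`. In weight four there are 36 convergent indices and 31 relations: 12 double shuffles for each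
sign and 7 such products. Solving them leaves A, ..., E, with integral coefficients. -/

/-! ### Words, signed indices and the two products -/

open PowerSeries in
/-- The formal primitive of `f` with respect to `dX / X`. -/
noncomputable def logPrimitive (f : ℝ⟦X⟧) : ℝ⟦X⟧ :=
  PowerSeries.mk fun n => coeff n f / n

/-- The series `∑ (a X)^n` over `n ≥ 1` for a letter `a ≠ 0`; the letter `0` stands for the form
`dX / X`. -/
noncomputable def letterSeries (a : ℤ) : PowerSeries ℝ :=
  if a = 0 then 1 else PowerSeries.mk fun n => if n = 0 then 0 else (a : ℝ) ^ n

/-- The generalized polylogarithm of a word, as a formal power series. -/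
noncomputable def wordSeries : List ℤ → PowerSeries ℝ
  | [] => 1
  | a :: w => logPrimitive (letterSeries a * wordSeries w)

/-- The words in `0, 1, -1` that do not end in `0`. -/
def IsWord : List ℤ → Prop
  | [] => True
  | a :: w => (a = 1 ∨ a = -1 ∨ a = 0 ∧ w ≠ []) ∧ IsWord w

/-- All insertions of the letter `x` into a word. -/
def shuffleOne (x : ℤ) : List ℤ → List (List ℤ)
  | [] => [[x]]
  | a :: w => (x :: a :: w) :: (shuffleOne x w).map (a :: ·)

/-- The quasi-shuffle product of the one-letter index `a` with an index. -/
def stuffleOne (a : ℤ) : List ℤ → List (List ℤ)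
  | [] => [[a]]
  | b :: k => (a :: b :: k) :: ((a.sign * b + b.sign * a) :: k) :: (stuffleOne a k).map (b :: ·)

/-- The word of a signed index, `e` being the product of the preceding signs. -/
def indexWord (e : ℤ) : List ℤ → List ℤ
  | [] => []
  | m :: k => List.replicate (m.natAbs - 1) 0 ++ (e * m.sign) :: indexWord (e * m.sign) k

/-- The signed index of the word `0 ^ z w`, relative to the preceding sign `e`. -/
def wordIndex (e : ℤ) (z : ℕ) : List ℤ → List ℤ
  | [] => []
  | a :: w => if a = 0 then wordIndex e (z + 1) w
      else ((z + 1 : ℕ) : ℤ) * (e * a) :: wordIndex a 0 w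

/-- The shuffle product of the one-letter index `x = ±1` with a signed index. -/
def shuffleIndex (x : ℤ) (k : List ℤ) : List (List ℤ) :=
  (shuffleOne x (indexWord 1 k)).map (wordIndex 1 0)

/-- The part of the nested sum with largest summation variable equal to `n`. -/
noncomputable def eulerTerm : List ℤ → ℕ → ℝ
  | [], n => if n = 0 then 1 else 0
  | m :: k, n => if n = 0 then 0
      else (m.sign : ℝ) ^ n / (n : ℝ) ^ m.natAbs * truncatedEulerSum k (n - 1)

/-! ### The shuffle product on power series -/

section algebra

open PowerSeries

theorem logPrimitive_add (f g : ℝ⟦X⟧) :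
    logPrimitive (f + g) = logPrimitive f + logPrimitive g := by
  ext n
  simp [logPrimitive, add_div]

/-- Integration by parts: coefficientwise, 1/(ij) = (1/i + 1/j)/(i + j). Constant terms must vanish
because `logPrimitive` divides by 0 there, with value 0. -/
theorem logPrimitive_mul_logPrimitive {f g : ℝ⟦X⟧} (hf : coeff 0 f = 0) (hg : coeff 0 g = 0) :
    logPrimitive f * logPrimitive g =
      logPrimitive (f * logPrimitive g) + logPrimitive (g * logPrimitive f) := by
  ext n
  rw [mul_comm g]
  simp only [map_add, coeff_mul, logPrimitive, coeff_mk, ← add_div, ← Finset.sum_add_distrib,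
    Finset.sum_div]
  refine Finset.sum_congr rfl fun p hp => ?_
  obtain ⟨i, j⟩ := p
  rw [Finset.HasAntidiagonal.mem_antidiagonal] at hp
  simp only at hp ⊢
  subst hp
  rcases Nat.eq_zero_or_pos i with rfl | hi
  · simp [hf]
  rcases Nat.eq_zero_or_pos j with rfl | hj
  · simp [hg]
  have : (i : ℝ) ≠ 0 := by positivity
  have : (j : ℝ) ≠ 0 := by positivity
  have : (i : ℝ) + j ≠ 0 := by positivity
  push_cast
  field_simp

theorem coeff_zero_wordSeries_cons (a : ℤ) (w : List ℤ) :
    coeff 0 (wordSeries (a :: w)) = 0 := by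
  simp [wordSeries, logPrimitive]

theorem coeff_zero_letterSeries_mul {a : ℤ} {w : List ℤ} (h : IsWord (a :: w)) :
    coeff 0 (letterSeries a * wordSeries w) = 0 := by
  by_cases ha : a = 0
  · obtain ⟨b, v, rfl⟩ : ∃ b v, w = b :: v := by
      have := h.1
      rcases w with _ | ⟨b, v⟩
      · simp [ha] at this
      · exact ⟨b, v, rfl⟩
    have := coeff_zero_wordSeries_cons b v
    simpa [letterSeries, ha] using this
  · simp [letterSeries, ha, coeff_mul]

theorem sum_map_wordSeries_cons (a : ℤ) (L : List (List ℤ)) :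
    ((L.map (a :: ·)).map wordSeries).sum =
      logPrimitive (letterSeries a * (L.map wordSeries).sum) := by
  induction L with
  | nil => ext n; simp [logPrimitive]
  | cons w L ih =>
    simp only [List.map_cons, List.sum_cons, ih, mul_add, logPrimitive_add, wordSeries]

/-- Both factors are primitives, so integration by parts strips the first letter from one or the
other: the two terms are the shuffles starting with `x` and those starting with `a`. -/
theorem wordSeries_singleton_mul {x : ℤ} (hx : x = 1 ∨ x = -1) (w : List ℤ)
    (hw : IsWord w) :
    wordSeries [x] * wordSeries w = ((shuffleOne x w).map wordSeries).sum := by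
  induction w with
  | nil => simp [shuffleOne, wordSeries]
  | cons a w ih =>
    rw [shuffleOne, List.map_cons, List.sum_cons, sum_map_wordSeries_cons, ← ih hw.2]
    have h1 : coeff 0 (letterSeries x * wordSeries []) = 0 :=
      coeff_zero_letterSeries_mul (w := []) ⟨by tauto, trivial⟩
    have h := logPrimitive_mul_logPrimitive h1 (coeff_zero_letterSeries_mul hw)
    rw [show wordSeries [x] = logPrimitive (letterSeries x * wordSeries []) from rfl,
      show wordSeries (a :: w) = logPrimitive (letterSeries a * wordSeries w) from rfl, h]
    congr 1
    · simp [wordSeries]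
    · congr 1; ring

theorem coeff_wordSeries_replicate_append (j : ℕ) (w : List ℤ) (n : ℕ) :
    coeff n (wordSeries (List.replicate j 0 ++ w)) = coeff n (wordSeries w) / (n : ℝ) ^ j := by
  induction j with
  | zero => simp
  | succ j ih =>
    rw [List.replicate_succ, List.cons_append, wordSeries]
    simp only [logPrimitive, coeff_mk, letterSeries, if_pos, one_mul, ih]
    rw [div_div, pow_succ]

theorem sum_eulerTerm (k : List ℤ) (N : ℕ) :
    ∑ n ∈ Finset.range (N + 1), eulerTerm k n = truncatedEulerSum k N := by
  cases k with
  | nil => simp [eulerTerm, truncatedEulerSum]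
  | cons m k =>
    rw [Finset.sum_range_succ']
    simp [eulerTerm, truncatedEulerSum]

/-- The nonzero letters are the running sign products a_j = e x_1⋯x_j. The geometric series
contribute a_j^(k_j - k_(j+1)), and these telescope to e^(k_1) ∏ x_j^(k_j). -/
theorem coeff_wordSeries_indexWord {k : List ℤ} (hk : IsSignedIndex k) {e : ℤ} (he : e ≠ 0)
    (n : ℕ) :
    coeff n (wordSeries (indexWord e k)) = (e : ℝ) ^ n * eulerTerm k n := by
  induction k generalizing e n with
  | nil =>
    rcases Nat.eq_zero_or_pos n with rfl | hn
    · simp [indexWord, wordSeries, eulerTerm]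
    · simp [indexWord, wordSeries, eulerTerm, hn.ne', coeff_one]
  | cons m k ih =>
    have hm : m ≠ 0 := hk m (by simp)
    have hk' : IsSignedIndex k := fun a ha => hk a (by simp [ha])
    have hs : e * m.sign ≠ 0 := mul_ne_zero he (by simpa [Int.sign_eq_zero_iff_zero] using hm)
    rw [indexWord, coeff_wordSeries_replicate_append, wordSeries]
    rcases Nat.eq_zero_or_pos n with rfl | hn
    · simp [logPrimitive, eulerTerm]
    obtain ⟨n, rfl⟩ : ∃ i, n = i + 1 := ⟨n - 1, by omega⟩
    -- `letterSeries` has no constant term, which makes the inequality k_1 > k_2 strict.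
    have key : coeff (n + 1) (letterSeries (e * m.sign) * wordSeries (indexWord (e * m.sign) k))
        = ((e * m.sign : ℤ) : ℝ) ^ (n + 1) * truncatedEulerSum k n := by
      rw [mul_comm, coeff_mul, Finset.Nat.sum_antidiagonal_eq_sum_range_succ_mk,
        Finset.sum_range_succ]
      simp only [letterSeries, hs, if_false, coeff_mk, ih hk' hs, Nat.sub_self, if_true, mul_zero,
        add_zero]
      rw [← sum_eulerTerm, Finset.mul_sum]
      refine Finset.sum_congr rfl fun i hi => ?_
      rw [Finset.mem_range] at hi
      rw [if_neg (by omega), mul_right_comm, ← pow_add, Nat.add_sub_cancel' (by omega)]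
    obtain ⟨p, hp⟩ : ∃ p, m.natAbs = p + 1 := ⟨m.natAbs - 1, by omega⟩
    simp only [logPrimitive, coeff_mk, key, eulerTerm, hp]
    simp only [Nat.add_sub_cancel, Nat.succ_ne_zero, if_false, Int.cast_mul]
    have : ((n + 1 : ℕ) : ℝ) ≠ 0 := by positivity
    field_simp
    ring

theorem sum_coeff_wordSeries_indexWord {k : List ℤ} (hk : IsSignedIndex k) (N : ℕ) :
    ∑ n ∈ Finset.range (N + 1), coeff n (wordSeries (indexWord 1 k)) = truncatedEulerSum k N := by
  rw [← sum_eulerTerm]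
  refine Finset.sum_congr rfl fun n _ => ?_
  simp [coeff_wordSeries_indexWord hk one_ne_zero]

theorem isWord_replicate_append (j : ℕ) {a : ℤ} {w : List ℤ} (h : IsWord (a :: w)) :
    IsWord (List.replicate j 0 ++ a :: w) := by
  induction j with
  | zero => simpa
  | succ j ih => exact ⟨by simp, ih⟩

theorem isWord_indexWord {k : List ℤ} (hk : IsSignedIndex k) {e : ℤ} (he : e = 1 ∨ e = -1) :
    IsWord (indexWord e k) := by
  induction k generalizing e with
  | nil => trivial
  | cons m k ih =>
    have hm : m ≠ 0 := hk m (by simp)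
    have hs : e * m.sign = 1 ∨ e * m.sign = -1 := by
      rcases lt_or_gt_of_ne hm with h | h <;> rcases he with rfl | rfl <;>
        simp [Int.sign_eq_neg_one_of_neg, Int.sign_eq_one_of_pos, h]
    exact isWord_replicate_append _ ⟨by tauto, ih (fun a ha => hk a (by simp [ha])) hs⟩

theorem isWord_of_mem_shuffleOne {x : ℤ} (hx : x = 1 ∨ x = -1) {w : List ℤ} (hw : IsWord w)
    {v : List ℤ} (hv : v ∈ shuffleOne x w) : IsWord v ∧ v ≠ [] := by
  induction w generalizing v with
  | nil =>
    obtain rfl : v = [x] := by simpa [shuffleOne] using hv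
    exact ⟨⟨by tauto, trivial⟩, by simp⟩
  | cons a w ih =>
    simp only [shuffleOne, List.mem_cons, List.mem_map] at hv
    rcases hv with rfl | ⟨u, hu, rfl⟩
    · exact ⟨⟨by tauto, hw⟩, by simp⟩
    · obtain ⟨h1, h2⟩ := ih hw.2 hu
      exact ⟨⟨by have := hw.1; tauto, h1⟩, by simp⟩

/-- Translates shuffled words back into indices. Letters being ±1, `e * a` is the quotient of
successive letters; `IsWord` excludes trailing zeros, which `wordIndex` would drop. -/
theorem indexWord_wordIndex {w : List ℤ} (hw : IsWord w) (hne : w ≠ []) {e : ℤ}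
    (he : e = 1 ∨ e = -1) (z : ℕ) :
    indexWord e (wordIndex e z w) = List.replicate z 0 ++ w := by
  induction w generalizing e z with
  | nil => exact absurd rfl hne
  | cons a w ih =>
    rw [wordIndex]
    split_ifs with ha
    · have hw0 : w ≠ [] := by have := hw.1; aesop
      rw [ih hw.2 hw0 he, ha, List.replicate_succ', List.append_assoc]
      rfl
    · have ha' : a = 1 ∨ a = -1 := by have := hw.1; tauto
      have hs : e * (((z + 1 : ℕ) : ℤ) * (e * a)).sign = a := by
        rw [Int.sign_mul, Int.sign_natCast_of_ne_zero (by omega)]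
        rcases he with rfl | rfl <;> rcases ha' with rfl | rfl <;> rfl
      have hn : (((z + 1 : ℕ) : ℤ) * (e * a)).natAbs - 1 = z := by
        rcases he with rfl | rfl <;> rcases ha' with rfl | rfl <;> simp <;> omega
      rw [indexWord, hs, hn]
      by_cases h0 : w = []
      · subst h0; rfl
      · rw [ih hw.2 h0 ha']; rfl

theorem isSignedIndex_wordIndex {w : List ℤ} {e : ℤ} (he : e ≠ 0) (z : ℕ) :
    IsSignedIndex (wordIndex e z w) := by
  induction w generalizing e z with
  | nil => simp [IsSignedIndex, wordIndex]
  | cons a w ih =>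
    rw [wordIndex]
    split_ifs with ha
    · exact ih he _
    · intro m hm
      rcases List.mem_cons.1 hm with rfl | hm
      · exact mul_ne_zero (by positivity) (mul_ne_zero he ha)
      · exact ih ha 0 m hm

theorem List.sum_map_finset_sum {α ι : Type*} (L : List α) (s : Finset ι) (f : α → ι → ℝ) :
    (L.map fun a => ∑ i ∈ s, f a i).sum = ∑ i ∈ s, (L.map fun a => f a i).sum := by
  induction L with
  | nil => simp
  | cons a L ih => simp [ih, Finset.sum_add_distrib]

theorem sum_coeff_mul_eq_sum_shuffleIndex {x : ℤ} (hx : x = 1 ∨ x = -1) {k : List ℤ}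
    (hk : IsSignedIndex k) (N : ℕ) :
    ∑ n ∈ Finset.range (N + 1), coeff n (wordSeries [x] * wordSeries (indexWord 1 k)) =
      ((shuffleIndex x k).map fun v => truncatedEulerSum v N).sum := by
  have hw := isWord_indexWord hk (e := 1) (by simp)
  rw [wordSeries_singleton_mul hx _ hw, shuffleIndex,
    List.map_map]
  simp only [map_list_sum, List.map_map]
  rw [← List.sum_map_finset_sum]
  refine congrArg List.sum (List.map_congr_left fun v hv => ?_)
  obtain ⟨h1, h2⟩ := isWord_of_mem_shuffleOne hx hw hv
  have h3 := sum_coeff_wordSeries_indexWord (isSignedIndex_wordIndex (w := v) one_ne_zero 0) N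
  rw [indexWord_wordIndex h1 h2 (by simp)] at h3
  simpa using h3

/-! ### The quasi-shuffle product on truncated sums -/

theorem sum_range_mul_sum_range (f g : ℕ → ℝ) (N : ℕ) :
    (∑ n ∈ Finset.range N, f n) * ∑ n ∈ Finset.range N, g n =
      ∑ n ∈ Finset.range N, (f n * ∑ i ∈ Finset.range n, g i + f n * g n +
        g n * ∑ i ∈ Finset.range n, f i) := by
  induction N with
  | zero => simp
  | succ N ih =>
    simp only [Finset.sum_range_succ _ N, ← ih]
    ring

theorem sum_map_truncatedEulerSum_cons (b : ℤ) (L : List (List ℤ)) (N : ℕ) :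
    ((L.map (b :: ·)).map fun k => truncatedEulerSum k N).sum =
      ∑ n ∈ Finset.range N, (b.sign : ℝ) ^ (n + 1) / ((n + 1 : ℕ) : ℝ) ^ b.natAbs *
        (L.map fun k => truncatedEulerSum k n).sum := by
  induction L with
  | nil => simp
  | cons k L ih =>
    simp only [List.map_cons, List.sum_cons, ih, mul_add, Finset.sum_add_distrib]
    rfl

/-- This is the quasi-shuffle term where both summation variables coincide: the merged entry
multiplies signs and adds absolute values. -/
theorem sign_pow_div_mul_sign_pow_div {a b : ℤ} (ha : a ≠ 0) (hb : b ≠ 0) (n : ℕ) (y : ℝ) :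
    (a.sign : ℝ) ^ n / y ^ a.natAbs * ((b.sign : ℝ) ^ n / y ^ b.natAbs) =
      ((a.sign * b + b.sign * a).sign : ℝ) ^ n / y ^ (a.sign * b + b.sign * a).natAbs := by
  have h1 : (a.sign * b + b.sign * a).sign = a.sign * b.sign := by
    rcases lt_or_gt_of_ne ha with h | h <;> rcases lt_or_gt_of_ne hb with h' | h' <;>
      simp only [Int.sign_eq_neg_one_of_neg, Int.sign_eq_one_of_pos, h, h']
    · rw [Int.sign_eq_one_of_pos] <;> omega
    · rw [Int.sign_eq_neg_one_of_neg] <;> omega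
    · rw [Int.sign_eq_neg_one_of_neg] <;> omega
    · rw [Int.sign_eq_one_of_pos] <;> omega
  have h2 : (a.sign * b + b.sign * a).natAbs = a.natAbs + b.natAbs := by
    rcases lt_or_gt_of_ne ha with h | h <;> rcases lt_or_gt_of_ne hb with h' | h' <;>
      simp only [Int.sign_eq_neg_one_of_neg, Int.sign_eq_one_of_pos, h, h'] <;> omega
  rw [h1, h2, pow_add, Int.cast_mul, mul_pow, div_mul_div_comm]

theorem truncatedEulerSum_singleton_mul {a : ℤ} (ha : a ≠ 0) {k : List ℤ} (hk : IsSignedIndex k)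
    (N : ℕ) :
    truncatedEulerSum [a] N * truncatedEulerSum k N =
      ((stuffleOne a k).map fun v => truncatedEulerSum v N).sum := by
  induction k generalizing N with
  | nil => simp [stuffleOne, truncatedEulerSum]
  | cons b k ih =>
    have hb : b ≠ 0 := hk b (by simp)
    have hk' : IsSignedIndex k := fun c hc => hk c (by simp [hc])
    rw [stuffleOne, List.map_cons, List.map_cons, List.sum_cons, List.sum_cons,
      sum_map_truncatedEulerSum_cons, truncatedEulerSum, truncatedEulerSum,
      sum_range_mul_sum_range]
    simp only [← ih hk']
    rw [truncatedEulerSum, truncatedEulerSum, ← Finset.sum_add_distrib, ← Finset.sum_add_distrib]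
    refine Finset.sum_congr rfl fun n _ => ?_
    rw [← sign_pow_div_mul_sign_pow_div ha hb]
    simp only [truncatedEulerSum]
    ring

end algebra

/-! ### Convergence with a rate, and comparison of the two products -/

section analysis

/-- `T` is a Cauchy sequence with remainders of order `1 / √(N + 1)`. -/
def HasSqrtRate (T : ℕ → ℝ) : Prop :=
  ∃ C : ℝ, ∀ M N : ℕ, M ≤ N → |T N - T M| ≤ C / √(M + 1)

theorem HasSqrtRate.exists_tendsto {T : ℕ → ℝ} (h : HasSqrtRate T) :
    ∃ l, Tendsto T atTop (𝓝 l) := by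
  obtain ⟨C, hC⟩ := h
  refine cauchySeq_tendsto_of_complete (cauchySeq_of_le_tendsto_0' (fun M : ℕ => C / √(M + 1))
    (fun M N h => ?_) ?_)
  · rw [dist_comm, Real.dist_eq]; exact hC M N h
  · refine Tendsto.const_div_atTop ?_ C
    exact Real.tendsto_sqrt_atTop.comp
      (tendsto_atTop_add_const_right _ _ tendsto_natCast_atTop_atTop)

/-- Telescoping bound: 1/a - 1/b = 1/(ab(a + b)), and b ≤ 3a/2 gives ab(a + b) ≤ (15/4)a³, whence
the 4. -/
theorem inv_mul_sqrt_le (n : ℕ) :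
    1 / ((n + 1 : ℝ) * √(n + 1)) ≤ 4 * (1 / √(n + 1) - 1 / √(n + 1 + 1)) := by
  set a := √((n : ℝ) + 1) with ha
  set b := √((n : ℝ) + 1 + 1) with hb
  have ha2 : a ^ 2 = n + 1 := Real.sq_sqrt (by positivity)
  have hb2 : b ^ 2 = n + 1 + 1 := Real.sq_sqrt (by positivity)
  have ha1 : 1 ≤ a := by rw [ha, Real.one_le_sqrt]; linarith [n.cast_nonneg (α := ℝ)]
  have hb0 : 0 < b := by positivity
  have hb1 : b ≤ 3 / 2 * a := by nlinarith
  have hd : (b - a) * (b + a) = 1 := by nlinarith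
  have h1 : 1 ≤ (b - a) * (5 / 2 * a) := by
    have : 0 ≤ b - a := by nlinarith
    nlinarith
  rw [← ha2, div_sub_div _ _ (by positivity) (by positivity), mul_div_assoc',
    div_le_div_iff₀ (by positivity) (by positivity)]
  have h2 : b * a ≤ 3 / 2 * a ^ 2 := by nlinarith
  have h3 : 0 ≤ a ^ 2 * ((b - a) * (5 / 2 * a) - 1) := by
    have := sub_nonneg.2 h1
    positivity
  nlinarith

/-- `u` is a corrector: `T - u` has increments of order n^(-3/2), which telescope, and `u` itself is
within the rate. -/
theorem hasSqrtRate_of_abs_le {T u : ℕ → ℝ} {C : ℝ}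
    (h : ∀ n : ℕ, |T (n + 1) - T n - (u (n + 1) - u n)| ≤ C * (1 / ((n + 1 : ℝ) * √(n + 1))))
    (hu : ∀ n : ℕ, |u n| ≤ C / √(n + 1)) : HasSqrtRate T := by
  have hC : 0 ≤ C := by
    have := (abs_nonneg _).trans (hu 0)
    simpa using this
  have key : ∀ M N : ℕ, M ≤ N →
      |T N - T M - (u N - u M)| ≤ 4 * C * (1 / √(M + 1) - 1 / √(N + 1)) := by
    intro M N hMN
    induction N, hMN using Nat.le_induction with
    | base => simp
    | succ N _ ih =>
      have h1 := (h N).trans (mul_le_mul_of_nonneg_left (inv_mul_sqrt_le N) hC)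
      have h2 := abs_add_le (T N - T M - (u N - u M)) (T (N + 1) - T N - (u (N + 1) - u N))
      push_cast
      calc _ = |T N - T M - (u N - u M) + (T (N + 1) - T N - (u (N + 1) - u N))| := by
            congr 1; ring
        _ ≤ _ := h2
        _ ≤ _ := add_le_add ih h1
        _ = _ := by ring
  refine ⟨6 * C, fun M N hMN => ?_⟩
  have h1 := key M N hMN
  have h2 : 1 / √((N : ℝ) + 1) ≤ 1 / √(M + 1) := by gcongr
  have h3 : C / √((N : ℝ) + 1) ≤ C / √(M + 1) := by gcongr
  have h4 : 0 ≤ 1 / √((N : ℝ) + 1) := by positivity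
  have h5 : T N - T M = (T N - T M - (u N - u M)) + (u N - u M) := by ring
  rw [h5]
  calc _ ≤ |T N - T M - (u N - u M)| + (|u N| + |u M|) :=
        (abs_add_le _ _).trans (add_le_add le_rfl (abs_sub _ _))
    _ ≤ 4 * C * (1 / √(M + 1)) + (C / √(M + 1) + C / √(M + 1)) := by
        refine add_le_add (h1.trans ?_) (add_le_add ((hu N).trans h3) (hu M))
        gcongr
        linarith
    _ = _ := by ring

theorem abs_sign_pow_div_le (m : ℤ) {j : ℕ} (hj : j ≤ m.natAbs) (n : ℕ) :
    |(m.sign : ℝ) ^ (n + 1) / ((n + 1 : ℕ) : ℝ) ^ m.natAbs| ≤ 1 / (n + 1 : ℝ) ^ j := by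
  have h1 : |(m.sign : ℝ)| ≤ 1 := by
    rcases lt_trichotomy m 0 with h | rfl | h <;>
      simp [Int.sign_eq_neg_one_of_neg, Int.sign_eq_one_of_pos, *]
  have h2 : (1 : ℝ) ≤ n + 1 := by linarith [n.cast_nonneg (α := ℝ)]
  rw [abs_div, abs_pow, abs_pow, Nat.abs_cast, Nat.cast_succ]
  gcongr
  exact pow_le_one₀ (abs_nonneg _) h1

theorem truncatedEulerSum_succ (m : ℤ) (k : List ℤ) (N : ℕ) :
    truncatedEulerSum (m :: k) (N + 1) - truncatedEulerSum (m :: k) N =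
      (m.sign : ℝ) ^ (N + 1) / ((N + 1 : ℕ) : ℝ) ^ m.natAbs * truncatedEulerSum k N := by
  simp [truncatedEulerSum, Finset.sum_range_succ]

/-- The true growth is at most a power of the logarithm; a square root absorbs it and survives the
induction at the cost of a factor 4, since 1/a ≤ 4(b - a). -/
theorem exists_abs_truncatedEulerSum_le {k : List ℤ} (hk : IsSignedIndex k) :
    ∃ C : ℝ, 0 ≤ C ∧ ∀ N : ℕ, |truncatedEulerSum k N| ≤ C * √(N + 1) := by
  induction k with
  | nil =>
    refine ⟨1, zero_le_one, fun N => ?_⟩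
    rw [truncatedEulerSum, abs_one, one_mul, Real.one_le_sqrt]
    linarith [N.cast_nonneg (α := ℝ)]
  | cons m k ih =>
    obtain ⟨C, hC, h⟩ := ih fun a ha => hk a (by simp [ha])
    have hm : m ≠ 0 := hk m (by simp)
    refine ⟨4 * C, by positivity, fun N => ?_⟩
    induction N with
    | zero => simpa [truncatedEulerSum] using hC
    | succ N ihN =>
      have h1 := truncatedEulerSum_succ m k N
      have h2 := abs_sign_pow_div_le m (j := 1) (by omega) N
      have h3 := mul_le_mul h2 (h N) (abs_nonneg _) (by positivity)
      rw [← abs_mul, ← h1, pow_one] at h3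
      set a := √((N : ℝ) + 1) with ha
      set b := √((N : ℝ) + 1 + 1) with hb
      have ha2 : a ^ 2 = N + 1 := Real.sq_sqrt (by positivity)
      have hb2 : b ^ 2 = N + 1 + 1 := Real.sq_sqrt (by positivity)
      have ha0 : 1 ≤ a := by rw [ha, Real.one_le_sqrt]; linarith [N.cast_nonneg (α := ℝ)]
      have hb1 : b ≤ 3 / 2 * a := by nlinarith
      have hd : (b - a) * (b + a) = 1 := by nlinarith
      have hab : a ≤ b := Real.sqrt_le_sqrt (by linarith)
      have h4 : 1 / a ≤ 4 * (b - a) := by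
        rw [div_le_iff₀ (by positivity)]
        nlinarith
      have h5 : 1 / ((N : ℝ) + 1) * (C * a) = C * (1 / a) := by
        rw [← ha2]
        field_simp
      have h6 := mul_le_mul_of_nonneg_left h4 hC
      have h7 := abs_sub_abs_le_abs_sub (truncatedEulerSum (m :: k) (N + 1))
        (truncatedEulerSum (m :: k) N)
      push_cast
      rw [← hb]
      linarith

theorem hasSqrtRate_truncatedEulerSum {k : List ℤ} (hk : IsConvergentIndex k) :
    HasSqrtRate (truncatedEulerSum k) := by
  rcases k with _ | ⟨m, k⟩
  · exact ⟨0, fun M N _ => by simp [truncatedEulerSum]⟩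
  have hk' : IsSignedIndex k := fun a ha => hk.1 a (by simp [ha])
  have hm : m ≠ 0 := hk.1 m (by simp)
  have hm1 : m ≠ 1 := fun h => hk.2 (by simp [h])
  obtain ⟨C, hC, h⟩ := exists_abs_truncatedEulerSum_le hk'
  have hsq : ∀ n : ℕ, √((n : ℝ) + 1) * √((n : ℝ) + 1) = n + 1 :=
    fun n => Real.mul_self_sqrt (by positivity)
  by_cases hm' : m = -1
  · subst hm'
    obtain ⟨C', hC', h'⟩ : ∃ C' : ℝ, 0 ≤ C' ∧ ∀ n : ℕ,
        |truncatedEulerSum k (n + 1) - truncatedEulerSum k n| ≤ C' / √(n + 1) := by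
      rcases k with _ | ⟨b, k⟩
      · exact ⟨0, le_rfl, fun n => by simp [truncatedEulerSum]⟩
      obtain ⟨C', hC', h'⟩ := exists_abs_truncatedEulerSum_le (k := k)
        fun a ha => hk' a (by simp [ha])
      refine ⟨C', hC', fun n => ?_⟩
      have hb : b ≠ 0 := hk' b (by simp)
      have h2 := abs_sign_pow_div_le b (j := 1) (by omega) n
      rw [truncatedEulerSum_succ, abs_mul]
      refine (mul_le_mul h2 (h' n) (abs_nonneg _) (by positivity)).trans_eq ?_
      rw [pow_one]
      field_simp
      rw [Real.sq_sqrt (by positivity)]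
      ring
    -- Averaging consecutive terms of the alternating sum: after correction the summand is half a
    -- difference of consecutive values of `truncatedEulerSum k n / (n + 1)`.
    refine hasSqrtRate_of_abs_le (C := C + C')
      (u := fun n => (-1) ^ n * (truncatedEulerSum k n / (n + 1)) / 2) (fun n => ?_) fun n => ?_
    · rw [truncatedEulerSum_succ]
      have e : ((Int.sign (-1) : ℤ) : ℝ) ^ (n + 1) / ((n + 1 : ℕ) : ℝ) ^ (Int.natAbs (-1)) *
          truncatedEulerSum k n - ((-1) ^ (n + 1) * (truncatedEulerSum k (n + 1) /
            ((n + 1 : ℕ) + 1)) / 2 - (-1) ^ n * (truncatedEulerSum k n / (n + 1)) / 2) =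
          (-1) ^ n * (1 / (2 * (n + 1 + 1))) * (truncatedEulerSum k (n + 1)
            - truncatedEulerSum k n) - (-1) ^ n * (1 / (2 * (n + 1) * (n + 1 + 1))) *
              truncatedEulerSum k n := by
        simp only [Int.sign_neg, Int.sign_one, Int.natAbs_neg, Int.natAbs_one]
        push_cast
        field_simp
        ring
      rw [e]
      refine (abs_sub _ _).trans ?_
      rw [abs_mul, abs_mul, abs_mul, abs_mul, abs_pow, abs_neg, abs_one, one_pow, one_mul, one_mul,
        abs_of_nonneg (by positivity : (0 : ℝ) ≤ 1 / (2 * (n + 1 + 1))),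
        abs_of_nonneg (by positivity : (0 : ℝ) ≤ 1 / (2 * (n + 1) * (n + 1 + 1))), add_comm C, add_mul]
      refine add_le_add ?_ ?_
      · refine (mul_le_mul_of_nonneg_left (h' n) (by positivity)).trans ?_
        rw [div_mul_div_comm, mul_one_div, one_mul]
        gcongr
        linarith [n.cast_nonneg (α := ℝ)]
      · refine (mul_le_mul_of_nonneg_left (h n) (by positivity)).trans ?_
        rw [mul_left_comm]
        gcongr
        rw [one_div_mul_eq_div, div_le_div_iff₀ (by positivity) (by positivity)]
        nlinarith [hsq n, n.cast_nonneg (α := ℝ)]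
    · rw [abs_div, abs_mul, abs_pow, abs_neg, abs_one, one_pow, one_mul, abs_div,
        abs_of_nonneg (by positivity : (0 : ℝ) ≤ n + 1), abs_two, div_div,
        div_le_div_iff₀ (by positivity) (by positivity)]
      have h1 := mul_le_mul_of_nonneg_right (h n) (Real.sqrt_nonneg ((n : ℝ) + 1))
      rw [mul_assoc, hsq] at h1
      nlinarith [n.cast_nonneg (α := ℝ)]
  -- Here |m| ≥ 2, so the summands are already O(n^(-3/2)).
  · refine hasSqrtRate_of_abs_le (C := C) (u := fun _ => 0) (fun n => ?_) fun n => ?_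
    · have h2 := abs_sign_pow_div_le m (j := 2) (by omega) n
      rw [truncatedEulerSum_succ, sub_self, sub_zero, abs_mul]
      refine (mul_le_mul h2 (h n) (abs_nonneg _) (by positivity)).trans_eq ?_
      field_simp
      rw [Real.sq_sqrt (by positivity)]
      ring
    · rw [abs_zero]; positivity

theorem tendsto_eulerSum {k : List ℤ} (hk : IsConvergentIndex k) :
    Tendsto (truncatedEulerSum k) atTop (𝓝 (eulerSum k)) :=
  tendsto_nhds_limUnder (hasSqrtRate_truncatedEulerSum hk).exists_tendsto

theorem tendsto_harmonic_div_sqrt :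
    Tendsto (fun N : ℕ => (∑ i ∈ Finset.range N, 1 / (i + 1 : ℝ)) / √(N + 1)) atTop (𝓝 0) := by
  have hN : Tendsto (fun N : ℕ => (N : ℝ) + 1) atTop atTop :=
    tendsto_atTop_add_const_right _ _ tendsto_natCast_atTop_atTop
  have h1 : Tendsto (fun N : ℕ => Real.log ((N : ℝ) + 1) / √(N + 1)) atTop (𝓝 0) := by
    have := (isLittleO_log_rpow_atTop (r := 1 / 2) (by norm_num)).tendsto_div_nhds_zero.comp hN
    refine this.congr fun N => ?_
    simp [Real.sqrt_eq_rpow]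
  have h2 : Tendsto (fun N : ℕ => 1 / √((N : ℝ) + 1)) atTop (𝓝 0) :=
    (Real.tendsto_sqrt_atTop.comp hN).const_div_atTop 1
  have h3 := h2.add h1
  rw [add_zero] at h3
  refine squeeze_zero (fun N => by positivity) (fun N => ?_) h3
  rw [← add_div]
  gcongr
  have h := harmonic_le_one_add_log N
  have h' : Real.log N ≤ Real.log (N + 1) := by
    rcases Nat.eq_zero_or_pos N with rfl | hN
    · simp
    · gcongr; linarith
  simp only [harmonic, Rat.cast_sum] at h
  push_cast at h
  simp only [one_div]
  linarith

/-- With G the partial sums of `g`, the gap is ∑ f_i (G_N - G_(N-i)), bounded by a multiple of the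
harmonic number over √(N + 1). The partial sums of `f` may diverge. -/
theorem tendsto_mul_sub_sum_convolution {f g : ℕ → ℝ} (hf0 : f 0 = 0)
    (hf : ∀ n : ℕ, |f (n + 1)| ≤ 1 / (n + 1))
    (hg : HasSqrtRate fun N => ∑ n ∈ Finset.range (N + 1), g n) :
    Tendsto (fun N => (∑ n ∈ Finset.range (N + 1), f n) * (∑ n ∈ Finset.range (N + 1), g n) -
      ∑ n ∈ Finset.range (N + 1), ∑ i ∈ Finset.range (n + 1), f i * g (n - i)) atTop (𝓝 0) := by
  obtain ⟨C, hC⟩ := hg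
  have hC0 : 0 ≤ C := by simpa using (abs_nonneg _).trans (hC 0 0 le_rfl)
  have h0 := tendsto_harmonic_div_sqrt.const_mul (2 * C)
  rw [mul_zero] at h0
  refine squeeze_zero_norm (fun N => ?_) h0
  rw [Real.norm_eq_abs, Finset.sum_range_diag_flip (N + 1) fun i j => f i * g j, Finset.sum_mul,
    ← Finset.sum_sub_distrib, Finset.sum_range_succ', hf0]
  simp only [zero_mul, Finset.sum_const_zero, sub_zero, add_zero]
  have hterm : ∀ i ∈ Finset.range N, |f (i + 1) * (∑ n ∈ Finset.range (N + 1), g n) -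
      ∑ j ∈ Finset.range (N + 1 - (i + 1)), f (i + 1) * g j| ≤
        C / √(N + 1) * (1 / (i + 1) + 1 / ((N - 1 - i : ℕ) + 1)) := by
    intro i hi
    rw [Finset.mem_range] at hi
    obtain ⟨p, rfl⟩ : ∃ p, N = p + 1 + i := ⟨N - 1 - i, by omega⟩
    rw [← Finset.mul_sum, ← mul_sub, abs_mul, show p + 1 + i + 1 - (i + 1) = p + 1 by omega,
      show p + 1 + i - 1 - i = p by omega]
    refine (mul_le_mul (hf i) (hC p (p + 1 + i) (by omega)) (abs_nonneg _)
      (by positivity)).trans ?_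
    push_cast
    set s := √((p : ℝ) + 1) with hs
    set t := √((p : ℝ) + 1 + i + 1) with ht
    have hs2 : s ^ 2 = p + 1 := Real.sq_sqrt (by positivity)
    have ht2 : t ^ 2 = p + 1 + i + 1 := Real.sq_sqrt (by positivity)
    have hst : s ≤ t := Real.sqrt_le_sqrt (by linarith [i.cast_nonneg (α := ℝ)])
    have hs0 : 0 < s := by positivity
    have ht0 : 0 < t := by positivity
    -- Since (i + 1) + (p + 1) = t², one has 1/(i + 1) + 1/(p + 1) = t²/((i + 1)s²).
    have e : C / t * (1 / ((i : ℝ) + 1) + 1 / (p + 1)) = 1 / ((i : ℝ) + 1) * (C / s) * (t / s) := by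
      rw [← hs2]
      field_simp
      rw [hs2, ht2]; ring
    rw [e]
    refine le_mul_of_one_le_right (by positivity) ?_
    rwa [one_le_div hs0]
  refine (Finset.abs_sum_le_sum_abs _ _).trans ((Finset.sum_le_sum hterm).trans_eq ?_)
  rw [← Finset.mul_sum, Finset.sum_add_distrib,
    Finset.sum_range_reflect (fun i : ℕ => 1 / ((i : ℝ) + 1)) N]
  ring

open PowerSeries in
theorem tendsto_sum_stuffleOne_sub_sum_shuffleIndex {x : ℤ} (hx : x = 1 ∨ x = -1) {k : List ℤ}
    (hk : IsConvergentIndex k) :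
    Tendsto (fun N => ((stuffleOne x k).map fun v => truncatedEulerSum v N).sum -
      ((shuffleIndex x k).map fun v => truncatedEulerSum v N).sum) atTop (𝓝 0) := by
  have hx0 : x ≠ 0 := by rcases hx with rfl | rfl <;> simp
  have hxs : IsSignedIndex [x] := by simpa [IsSignedIndex] using hx0
  have hxa : |(x : ℝ)| = 1 := by rcases hx with rfl | rfl <;> simp
  have hw : indexWord 1 [x] = [x] := by rcases hx with rfl | rfl <;> rfl
  have hc : ∀ n, coeff n (wordSeries [x]) = eulerTerm [x] n := fun n => by
    simpa [hw] using coeff_wordSeries_indexWord hxs one_ne_zero n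
  have hsg : x.sign = x ∧ x.natAbs = 1 := by rcases hx with rfl | rfl <;> simp
  have h := tendsto_mul_sub_sum_convolution (f := fun n => coeff n (wordSeries [x]))
    (g := fun n => coeff n (wordSeries (indexWord 1 k)))
    (by simp only [hc]; simp [eulerTerm])
    (fun n => by
      simp only [hc]
      simp [eulerTerm, truncatedEulerSum, hsg, abs_div, hxa]
      rw [abs_of_nonneg (by positivity)])
    (by simpa only [sum_coeff_wordSeries_indexWord hk.1] using hasSqrtRate_truncatedEulerSum hk)
  refine h.congr fun N => ?_
  rw [← sum_coeff_mul_eq_sum_shuffleIndex hx hk.1, ← truncatedEulerSum_singleton_mul hx0 hk.1,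
    sum_coeff_wordSeries_indexWord hk.1]
  have h1 := sum_coeff_wordSeries_indexWord hxs N
  rw [hw] at h1
  rw [h1]
  simp only [coeff_mul, Finset.Nat.sum_antidiagonal_eq_sum_range_succ_mk]

theorem tendsto_sum_map_eulerSum {L : List (List ℤ)} (hL : ∀ k ∈ L, IsConvergentIndex k) :
    Tendsto (fun N => (L.map fun k => truncatedEulerSum k N).sum) atTop
      (𝓝 (L.map eulerSum).sum) := by
  induction L with
  | nil => simp
  | cons k L ih =>
    simp only [List.map_cons, List.sum_cons]
    exact (tendsto_eulerSum (hL k (by simp))).add (ih fun v hv => hL v (by simp [hv]))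

theorem eulerSum_singleton_mul {a : ℤ} (ha : a ≠ 0) {k : List ℤ} (hk : IsConvergentIndex k)
    (ha' : IsConvergentIndex [a]) (h : ∀ v ∈ stuffleOne a k, IsConvergentIndex v) :
    eulerSum [a] * eulerSum k = ((stuffleOne a k).map eulerSum).sum := by
  refine tendsto_nhds_unique ((tendsto_eulerSum ha').mul (tendsto_eulerSum hk)) ?_
  simpa only [truncatedEulerSum_singleton_mul ha hk.1] using tendsto_sum_map_eulerSum h

/-- The (regularized) double shuffle relation with a one-letter index of weight one: the first `i`
terms, which may diverge, are the same on both sides and cancel. -/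
theorem sum_stuffleOne_eq_sum_shuffleIndex {x : ℤ} (hx : x = 1 ∨ x = -1) {k : List ℤ} (i : ℕ)
    (hk : IsConvergentIndex k) (hi : (stuffleOne x k).take i = (shuffleIndex x k).take i)
    (h : ∀ v ∈ (stuffleOne x k).drop i ++ (shuffleIndex x k).drop i, IsConvergentIndex v) :
    (((stuffleOne x k).drop i).map eulerSum).sum =
      (((shuffleIndex x k).drop i).map eulerSum).sum := by
  have h1 := tendsto_sum_map_eulerSum fun v hv => h v (List.mem_append_left _ hv)
  have h2 := tendsto_sum_map_eulerSum fun v hv => h v (List.mem_append_right _ hv)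
  refine sub_eq_zero.1 (tendsto_nhds_unique (h1.sub h2) ?_)
  refine (tendsto_sum_stuffleOne_sub_sum_shuffleIndex hx hk).congr fun N => ?_
  conv_lhs => rw [← List.take_append_drop i (stuffleOne x k),
    ← List.take_append_drop i (shuffleIndex x k), hi]
  simp only [List.map_append, List.sum_append, add_sub_add_left_eq_sub]

end analysis

/-! ### Solving the relations in weights two, three and four -/

instance : DecidablePred IsSignedIndex := fun k =>
  inferInstanceAs (Decidable (∀ m ∈ k, m ≠ 0))

instance : DecidablePred IsConvergentIndex := fun k =>
  inferInstanceAs (Decidable (IsSignedIndex k ∧ k.head? ≠ some 1))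

/-- Double shuffle with the index `(-1)` for `x = -1`, and the regularized relation for `x = 1`, in
which the first term of either side diverges. -/
theorem double_shuffle (x : ℤ) (k : List ℤ) (i : ℕ)
    (h : (x = 1 ∨ x = -1) ∧ IsConvergentIndex k ∧
      (stuffleOne x k).take i = (shuffleIndex x k).take i ∧
      ∀ v ∈ (stuffleOne x k).drop i ++ (shuffleIndex x k).drop i, IsConvergentIndex v := by decide) :
    (((stuffleOne x k).drop i).map eulerSum).sum =
      (((shuffleIndex x k).drop i).map eulerSum).sum :=
  sum_stuffleOne_eq_sum_shuffleIndex h.1 i h.2.1 h.2.2.1 h.2.2.2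

theorem eulerSum_neg_one_mul (k : List ℤ)
    (h : IsConvergentIndex k ∧ ∀ v ∈ stuffleOne (-1) k, IsConvergentIndex v := by decide) :
    eulerSum [-1] * eulerSum k = ((stuffleOne (-1) k).map eulerSum).sum :=
  eulerSum_singleton_mul (by decide) h.1 (by decide) h.2

theorem int_sign_two : Int.sign 2 = 1 := rfl
theorem int_sign_three : Int.sign 3 = 1 := rfl

theorem eulerSum_two : eulerSum [2] = -2 * eulerSum [-2] := by
  have h1 := double_shuffle 1 [-1] 1
  have h2 := double_shuffle (-1) [-1] 0
  simp [stuffleOne, shuffleOne, shuffleIndex, indexWord, wordIndex] at h1 h2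
  linarith

theorem eulerSum_weight_three :
    eulerSum [2, 1] = 8 * eulerSum [-1, 1, -1] - 8 * eulerSum [-1, -1, -1] + 8 * eulerSum [-1, 2] ∧
    eulerSum [-2, -1] = -7 * eulerSum [-1, 1, -1] + 7 * eulerSum [-1, -1, -1] - 4 * eulerSum [-1, 2] ∧
    eulerSum [-2, 1] = eulerSum [-1, 1, -1] - eulerSum [-1, -1, -1] + eulerSum [-1, 2] ∧
    eulerSum [2, -1] = 2 * eulerSum [-1, 1, -1] - 2 * eulerSum [-1, -1, -1] - eulerSum [-1, 2] ∧
    eulerSum [-1, -2] = eulerSum [-1, 1, -1] - eulerSum [-1, -1, -1] - eulerSum [-1, 2] ∧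
    eulerSum [-3] = -6 * eulerSum [-1, 1, -1] + 6 * eulerSum [-1, -1, -1] - 6 * eulerSum [-1, 2] ∧
    eulerSum [3] = 8 * eulerSum [-1, 1, -1] - 8 * eulerSum [-1, -1, -1] + 8 * eulerSum [-1, 2] := by
  -- The weight-two relation times `eulerSum [-1]`, to be expanded by quasi-shuffle.
  have h0 : eulerSum [-1] * (eulerSum [2] + 2 * eulerSum [-2]) = 0 := by
    rw [eulerSum_two]; ring
  rw [mul_add, mul_left_comm, eulerSum_neg_one_mul [2], eulerSum_neg_one_mul [-2]] at h0
  have h1 := double_shuffle 1 [-1, 1] 1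
  have h2 := double_shuffle 1 [-1, -1] 1
  have h3 := double_shuffle 1 [2] 1
  have h4 := double_shuffle 1 [-2] 1
  have h5 := double_shuffle (-1) [-1, 1] 0
  have h6 := double_shuffle (-1) [-1, -1] 0
  have h7 := double_shuffle (-1) [2] 0
  have h8 := double_shuffle (-1) [-2] 0
  simp [stuffleOne, shuffleOne, shuffleIndex, indexWord, wordIndex, int_sign_two]
    at h0 h1 h2 h3 h4 h5 h6 h7 h8
  and_intros <;> grind

theorem eulerSum_weight_four (A B C D E : ℝ)
    (hA : A = eulerSum [-2, 1, 1]) (hB : B = eulerSum [-2, 2]) (hC : C = eulerSum [-1, 2, 1])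
    (hD : D = eulerSum [-1, 1, 2]) (hE : E = eulerSum [-1, 1, 1, 1]) :
    eulerSum [4] = 64 * A + 16 * B ∧
    eulerSum [-4] = -56 * A - 14 * B ∧
    eulerSum [3, 1] = 16 * A + 4 * B ∧
    eulerSum [3, -1] = 118 * A + 19 * B + 14 * C ∧
    eulerSum [2, 2] = 48 * A + 12 * B ∧
    eulerSum [-3, 1] = 10 * A + 2 * B ∧
    eulerSum [-3, -1] = -140 * A - 24 * B - 14 * C ∧
    eulerSum [2, -2] = -24 * A - 7 * B ∧
    eulerSum [-2, -2] = -12 * A - 3 * B ∧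
    eulerSum [-1, 3] = -38 * A - 5 * B - 6 * C ∧
    eulerSum [-1, -3] = 58 * A + 8 * B + 8 * C ∧
    eulerSum [2, 1, 1] = 64 * A + 16 * B ∧
    eulerSum [2, 1, -1] = 16 * A + 2 * B + 6 * C + 3 * D ∧
    eulerSum [2, -1, 1] = 22 * A + 3 * B + C - 3 * D ∧
    eulerSum [2, -1, -1] = 100 * A + 13 * B + 9 * C - 6 * D ∧
    eulerSum [-2, 1, -1] = 91 * A + 14 * B + 8 * C - 3 * D ∧
    eulerSum [-2, -1, 1] = -161 * A - 26 * B - 15 * C + 3 * D ∧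
    eulerSum [-2, -1, -1] = -101 * A - 14 * B - 9 * C + 6 * D ∧
    eulerSum [-1, 2, -1] = -102 * A - 14 * B - 8 * C + 6 * D ∧
    eulerSum [-1, -2, 1] = 69 * A + 11 * B + 8 * C ∧
    eulerSum [-1, -2, -1] = 63 * A + 8 * B + 3 * C - 6 * D ∧
    eulerSum [-1, 1, -2] = 21 * A + 3 * B + C - 2 * D ∧
    eulerSum [-1, -1, -2] = A + 2 * B + D ∧
    eulerSum [-1, 1, 1, -1] = A + E ∧
    eulerSum [-1, 1, -1, 1] = 11 * A + 2 * B + C + E ∧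
    eulerSum [-1, 1, -1, -1] = C + E ∧
    eulerSum [-1, -1, 1, 1] = -83 * A - 16 * B - 5 * C + D + E ∧
    eulerSum [-1, -1, 1, -1] = -38 * A - 5 * B - 5 * C + D + E ∧
    eulerSum [-1, -1, -1, 1] = D + E ∧
    eulerSum [-1, -1, -1, -1] = A + B + D + E ∧
    -- Absent from the tables, but needed for the integrality of all 36 sums.
    eulerSum [-1, -1, 2] = -2 * A - 3 * B + C - 2 * D := by
  obtain ⟨w1, w2, w3, w4, w5, w6, w7⟩ := eulerSum_weight_three
  have n1 := eulerSum_neg_one_mul [-1, 1, -1]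
  have n2 := eulerSum_neg_one_mul [-1, -1, -1]
  have n3 := eulerSum_neg_one_mul [-1, 2]
  have m1 := eulerSum_neg_one_mul [2, 1]
  have m2 := eulerSum_neg_one_mul [-2, -1]
  have m3 := eulerSum_neg_one_mul [-2, 1]
  have m4 := eulerSum_neg_one_mul [2, -1]
  have m5 := eulerSum_neg_one_mul [-1, -2]
  have m6 := eulerSum_neg_one_mul [-3]
  have m7 := eulerSum_neg_one_mul [3]
  rw [w1] at m1
  rw [w2] at m2
  rw [w3] at m3
  rw [w4] at m4
  rw [w5] at m5
  rw [w6] at m6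
  rw [w7] at m7
  have h1 := double_shuffle 1 [-1, 1, 1] 1
  have h2 := double_shuffle 1 [-1, 1, -1] 1
  have h3 := double_shuffle 1 [-1, -1, 1] 1
  have h4 := double_shuffle 1 [-1, -1, -1] 1
  have h5 := double_shuffle 1 [-1, 2] 1
  have h6 := double_shuffle 1 [-1, -2] 1
  have h7 := double_shuffle 1 [2, 1] 1
  have h8 := double_shuffle 1 [2, -1] 1
  have h9 := double_shuffle 1 [-2, 1] 1
  have h10 := double_shuffle 1 [-2, -1] 1
  have h11 := double_shuffle 1 [3] 1
  have h12 := double_shuffle 1 [-3] 1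
  have h13 := double_shuffle (-1) [-1, 1, 1] 0
  have h14 := double_shuffle (-1) [-1, 1, -1] 0
  have h15 := double_shuffle (-1) [-1, -1, 1] 0
  have h16 := double_shuffle (-1) [-1, -1, -1] 0
  have h17 := double_shuffle (-1) [-1, 2] 0
  have h18 := double_shuffle (-1) [-1, -2] 0
  have h19 := double_shuffle (-1) [2, 1] 0
  have h20 := double_shuffle (-1) [2, -1] 0
  have h21 := double_shuffle (-1) [-2, 1] 0
  have h22 := double_shuffle (-1) [-2, -1] 0
  have h23 := double_shuffle (-1) [3] 0
  have h24 := double_shuffle (-1) [-3] 0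
  simp [stuffleOne, shuffleOne, shuffleIndex, indexWord, wordIndex, int_sign_two, int_sign_three]
    at n1 n2 n3 m1 m2 m3 m4 m5 m6 m7
      h1 h2 h3 h4 h5 h6 h7 h8 h9 h10 h11 h12
      h13 h14 h15 h16 h17 h18 h19 h20 h21 h22 h23 h24
  -- Distributing isolates the three products evaluated by `n1`, `n2`, `n3`; substituting them makes
  -- `m1`, ..., `m7` linear.
  replace m1 := m1.symm.trans (show _ =
      8 * (eulerSum [-1] * eulerSum [-1, 1, -1]) -
      8 * (eulerSum [-1] * eulerSum [-1, -1, -1]) +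
      8 * (eulerSum [-1] * eulerSum [-1, 2]) by
    ring)
  replace m2 := m2.symm.trans (show _ =
      -7 * (eulerSum [-1] * eulerSum [-1, 1, -1]) +
      7 * (eulerSum [-1] * eulerSum [-1, -1, -1]) -
      4 * (eulerSum [-1] * eulerSum [-1, 2]) by
    ring)
  replace m3 := m3.symm.trans (show _ =
      (eulerSum [-1] * eulerSum [-1, 1, -1]) -
      (eulerSum [-1] * eulerSum [-1, -1, -1]) +
      (eulerSum [-1] * eulerSum [-1, 2]) by
    ring)
  replace m4 := m4.symm.trans (show _ =
      2 * (eulerSum [-1] * eulerSum [-1, 1, -1]) -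
      2 * (eulerSum [-1] * eulerSum [-1, -1, -1]) -
      (eulerSum [-1] * eulerSum [-1, 2]) by
    ring)
  replace m5 := m5.symm.trans (show _ =
      (eulerSum [-1] * eulerSum [-1, 1, -1]) -
      (eulerSum [-1] * eulerSum [-1, -1, -1]) -
      (eulerSum [-1] * eulerSum [-1, 2]) by
    ring)
  replace m6 := m6.symm.trans (show _ =
      -6 * (eulerSum [-1] * eulerSum [-1, 1, -1]) +
      6 * (eulerSum [-1] * eulerSum [-1, -1, -1]) -
      6 * (eulerSum [-1] * eulerSum [-1, 2]) by
    ring)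
  replace m7 := m7.symm.trans (show _ =
      8 * (eulerSum [-1] * eulerSum [-1, 1, -1]) -
      8 * (eulerSum [-1] * eulerSum [-1, -1, -1]) +
      8 * (eulerSum [-1] * eulerSum [-1, 2]) by
    ring)
  rw [n1, n2, n3] at m1 m2 m3 m4 m5 m6 m7
  clear w1 w2 w3 w4 w5 w6 w7 n1 n2 n3
  -- What remains is linear: 31 equations for the 31 sums other than A, ..., E.
  and_intros <;> grind

/-! ### Enumeration of the indices and conclusion -/

/-- The signed indices of a given weight. -/
def indicesOfWeight : ℕ → List (List ℤ)
  | 0 => [[]]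
  | n + 1 => (indicesOfWeight n).flatMap fun k => (1 :: k) :: (-1 :: k) ::
      match k with
      | [] => []
      | m :: k => [(m + m.sign) :: k]

theorem mem_indicesOfWeight {k : List ℤ} (hk : IsSignedIndex k) :
    k ∈ indicesOfWeight (signedWeight k) := by
  induction h : signedWeight k generalizing k with
  | zero =>
    rcases k with _ | ⟨m, k⟩
    · simp [indicesOfWeight]
    · have hm : m ≠ 0 := hk m (by simp)
      simp [signedWeight, hm] at h
  | succ n ih =>
    rcases k with _ | ⟨m, k⟩
    · simp [signedWeight] at h
    have hm : m ≠ 0 := hk m (by simp)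
    have hk' : IsSignedIndex k := fun a ha => hk a (by simp [ha])
    have hw : m.natAbs + signedWeight k = n + 1 := by simpa [signedWeight] using h
    rw [indicesOfWeight, List.mem_flatMap]
    by_cases h1 : m.natAbs = 1
    · refine ⟨k, ih hk' (by omega), ?_⟩
      rcases Int.natAbs_eq_iff.1 h1 with rfl | rfl <;> simp
    -- `p` is the first entry moved one step towards 0, undoing the third construction of
    -- `indicesOfWeight`.
    · obtain ⟨p, hp, hp', hpm⟩ : ∃ p : ℤ, p ≠ 0 ∧ p.natAbs + 1 = m.natAbs ∧ p + p.sign = m := by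
        rcases lt_or_gt_of_ne hm with hm' | hm'
        · refine ⟨m + 1, by omega, by omega, ?_⟩
          rw [Int.sign_eq_neg_one_of_neg (by omega)]; ring
        · refine ⟨m - 1, by omega, by omega, ?_⟩
          rw [Int.sign_eq_one_of_pos (by omega)]; ring
      refine ⟨p :: k, ih ?_ ?_, by simp [hpm]⟩
      · intro a ha
        rcases List.mem_cons.1 ha with rfl | ha
        · exact hp
        · exact hk' a ha
      · rw [signedWeight, List.map_cons, List.sum_cons]
        change p.natAbs + signedWeight k = n
        omega

theorem proposition3p5 (A B C D E : ℝ)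
    (hA : A = eulerSum [-2, 1, 1]) (hB : B = eulerSum [-2, 2]) (hC : C = eulerSum [-1, 2, 1])
    (hD : D = eulerSum [-1, 1, 2]) (hE : E = eulerSum [-1, 1, 1, 1]) :
    -- every weight four series converges and its sum is an integral combination
    (∀ k : List ℤ, IsConvergentIndex k → signedWeight k = 4 →
      Tendsto (truncatedEulerSum k) atTop (𝓝 (eulerSum k)) ∧
      ∃ a b c d e : ℤ, eulerSum k = a * A + b * B + c * C + d * D + e * E) ∧
    -- the tables
    eulerSum [4] = 64 * A + 16 * B ∧
    eulerSum [-4] = -56 * A - 14 * B ∧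
    eulerSum [3, 1] = 16 * A + 4 * B ∧
    eulerSum [3, -1] = 118 * A + 19 * B + 14 * C ∧
    eulerSum [2, 2] = 48 * A + 12 * B ∧
    eulerSum [-3, 1] = 10 * A + 2 * B ∧
    eulerSum [-3, -1] = -140 * A - 24 * B - 14 * C ∧
    eulerSum [2, -2] = -24 * A - 7 * B ∧
    eulerSum [-2, -2] = -12 * A - 3 * B ∧
    eulerSum [-1, 3] = -38 * A - 5 * B - 6 * C ∧
    eulerSum [-1, -3] = 58 * A + 8 * B + 8 * C ∧
    eulerSum [2, 1, 1] = 64 * A + 16 * B ∧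
    eulerSum [2, 1, -1] = 16 * A + 2 * B + 6 * C + 3 * D ∧
    eulerSum [2, -1, 1] = 22 * A + 3 * B + C - 3 * D ∧
    eulerSum [2, -1, -1] = 100 * A + 13 * B + 9 * C - 6 * D ∧
    eulerSum [-2, 1, -1] = 91 * A + 14 * B + 8 * C - 3 * D ∧
    eulerSum [-2, -1, 1] = -161 * A - 26 * B - 15 * C + 3 * D ∧
    eulerSum [-2, -1, -1] = -101 * A - 14 * B - 9 * C + 6 * D ∧
    eulerSum [-1, 2, -1] = -102 * A - 14 * B - 8 * C + 6 * D ∧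
    eulerSum [-1, -2, 1] = 69 * A + 11 * B + 8 * C ∧
    eulerSum [-1, -2, -1] = 63 * A + 8 * B + 3 * C - 6 * D ∧
    eulerSum [-1, 1, -2] = 21 * A + 3 * B + C - 2 * D ∧
    eulerSum [-1, -1, -2] = A + 2 * B + D ∧
    eulerSum [-1, 1, 1, -1] = A + E ∧
    eulerSum [-1, 1, -1, 1] = 11 * A + 2 * B + C + E ∧
    eulerSum [-1, 1, -1, -1] = C + E ∧
    eulerSum [-1, -1, 1, 1] = -83 * A - 16 * B - 5 * C + D + E ∧
    eulerSum [-1, -1, 1, -1] = -38 * A - 5 * B - 5 * C + D + E ∧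
    eulerSum [-1, -1, -1, 1] = D + E ∧
    eulerSum [-1, -1, -1, -1] = A + B + D + E := by
  obtain ⟨t1, t2, t3, t4, t5, t6, t7, t8, t9, t10, t11, t12, t13, t14, t15, t16,
    t17, t18, t19, t20, t21, t22, t23, t24, t25, t26, t27, t28, t29, t30, t31⟩ :=
    eulerSum_weight_four A B C D E hA hB hC hD hE
  refine ⟨fun k hk hw => ⟨tendsto_eulerSum hk, ?_⟩,
    t1, t2, t3, t4, t5, t6, t7, t8, t9, t10, t11, t12, t13, t14, t15, t16,
    t17, t18, t19, t20, t21, t22, t23, t24, t25, t26, t27, t28, t29, t30⟩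
  -- Integrality becomes a finite check over the explicit list of convergent indices.
  have hmem : k ∈ (indicesOfWeight 4).filter IsConvergentIndex :=
    List.mem_filter.2 ⟨hw ▸ mem_indicesOfWeight hk.1, decide_eq_true hk⟩
  revert k
  suffices ∀ k ∈ (indicesOfWeight 4).filter IsConvergentIndex,
      ∃ a b c d e : ℤ, eulerSum k = a * A + b * B + c * C + d * D + e * E from
    fun k _ _ hk => this k hk
  rw [show (indicesOfWeight 4).filter IsConvergentIndex =
      [[-1, 1, 1, 1], [2, 1, 1], [-1, -1, 1, 1], [-2, 1, 1], [-1, 2, 1], [3, 1],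
      [-1, 1, -1, 1], [2, -1, 1], [-1, -1, -1, 1], [-2, -1, 1], [-1, -2, 1], [-3, 1],
      [-1, 1, 2], [2, 2], [-1, -1, 2], [-2, 2], [-1, 3], [4], [-1, 1, 1, -1], [2, 1, -1],
      [-1, -1, 1, -1], [-2, 1, -1], [-1, 2, -1], [3, -1], [-1, 1, -1, -1], [2, -1, -1],
      [-1, -1, -1, -1], [-2, -1, -1], [-1, -2, -1], [-3, -1], [-1, 1, -2], [2, -2],
      [-1, -1, -2], [-2, -2], [-1, -3], [-4]] by decide]
  simp only [List.forall_mem_cons, List.not_mem_nil, false_implies, implies_true, and_true]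
  refine ⟨⟨0, 0, 0, 0, 1, by rw [← hE]; push_cast; ring⟩,
    ⟨64, 16, 0, 0, 0, by rw [t12]; push_cast; ring⟩,
    ⟨-83, -16, -5, 1, 1, by rw [t27]; push_cast; ring⟩,
    ⟨1, 0, 0, 0, 0, by rw [← hA]; push_cast; ring⟩,
    ⟨0, 0, 1, 0, 0, by rw [← hC]; push_cast; ring⟩,
    ⟨16, 4, 0, 0, 0, by rw [t3]; push_cast; ring⟩,
    ⟨11, 2, 1, 0, 1, by rw [t25]; push_cast; ring⟩,
    ⟨22, 3, 1, -3, 0, by rw [t14]; push_cast; ring⟩,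
    ⟨0, 0, 0, 1, 1, by rw [t29]; push_cast; ring⟩,
    ⟨-161, -26, -15, 3, 0, by rw [t17]; push_cast; ring⟩,
    ⟨69, 11, 8, 0, 0, by rw [t20]; push_cast; ring⟩,
    ⟨10, 2, 0, 0, 0, by rw [t6]; push_cast; ring⟩,
    ⟨0, 0, 0, 1, 0, by rw [← hD]; push_cast; ring⟩,
    ⟨48, 12, 0, 0, 0, by rw [t5]; push_cast; ring⟩,
    ⟨-2, -3, 1, -2, 0, by rw [t31]; push_cast; ring⟩,
    ⟨0, 1, 0, 0, 0, by rw [← hB]; push_cast; ring⟩,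
    ⟨-38, -5, -6, 0, 0, by rw [t10]; push_cast; ring⟩,
    ⟨64, 16, 0, 0, 0, by rw [t1]; push_cast; ring⟩,
    ⟨1, 0, 0, 0, 1, by rw [t24]; push_cast; ring⟩,
    ⟨16, 2, 6, 3, 0, by rw [t13]; push_cast; ring⟩,
    ⟨-38, -5, -5, 1, 1, by rw [t28]; push_cast; ring⟩,
    ⟨91, 14, 8, -3, 0, by rw [t16]; push_cast; ring⟩,
    ⟨-102, -14, -8, 6, 0, by rw [t19]; push_cast; ring⟩,
    ⟨118, 19, 14, 0, 0, by rw [t4]; push_cast; ring⟩,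
    ⟨0, 0, 1, 0, 1, by rw [t26]; push_cast; ring⟩,
    ⟨100, 13, 9, -6, 0, by rw [t15]; push_cast; ring⟩,
    ⟨1, 1, 0, 1, 1, by rw [t30]; push_cast; ring⟩,
    ⟨-101, -14, -9, 6, 0, by rw [t18]; push_cast; ring⟩,
    ⟨63, 8, 3, -6, 0, by rw [t21]; push_cast; ring⟩,
    ⟨-140, -24, -14, 0, 0, by rw [t7]; push_cast; ring⟩,
    ⟨21, 3, 1, -2, 0, by rw [t22]; push_cast; ring⟩,
    ⟨-24, -7, 0, 0, 0, by rw [t8]; push_cast; ring⟩,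
    ⟨1, 2, 0, 1, 0, by rw [t23]; push_cast; ring⟩,
    ⟨-12, -3, 0, 0, 0, by rw [t9]; push_cast; ring⟩,
    ⟨58, 8, 8, 0, 0, by rw [t11]; push_cast; ring⟩,
    ⟨-56, -14, 0, 0, 0, by rw [t2]; push_cast; ring⟩⟩
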